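/- Let $d\ge 3$ and let $S_0=0$, $S_n=X_1+\dots+X_n$ be the simple symmetric random walk on $\mathbb Z^d$, where $X_1,X_2,\dots$ are i.i.d. with $P(X_1=e_i)=P(X_1=-e_i)=\frac1{2d}$ for $i=1,\dots,d$, and $e_1,\dots,e_d$ are the standard unit vectors. Let $\xi(x,n)=\#\{k: 0<k\le n,\ S_k=x\}$ be the local time at $x\in\mathbb Z^d$, let $\xi(n)=\max_{x\in\mathbb Z^d}\xi(x,n)$ be the maximal local time, let $\gamma=P(S_n\ne 0\text{ for all } n\ge 1)$ be the probability that the walk never returns to the origin, and put $\lambda=-1/\log(1-\gamma)$. Then, with probability $1$, for every $\varepsilon>0$ there is a (random) $n_0$ such that for all $n\ge n_0$ $$\xi(n)\ \ge\ \lambda\log n-\lambda(2+\varepsilon)\log\log n .$$ -/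

import Mathlib

open MeasureTheory ProbabilityTheory

noncomputable section

/-- The steps of a simple symmetric random walk on `ℤ^d`: the vectors `X 0, X 1, X 2, …` (the first,
second, third, … step) are independent random variables on `(Ω, μ)`, each of which takes each of the
values `e_i` and `-e_i`, `i = 1, …, d`, with probability `1 / (2 d)`. -/
structure IsSimpleRandomWalkSteps {Ω : Type*} [MeasurableSpace Ω] (d : ℕ) (μ : Measure Ω)
    (X : ℕ → Ω → (Fin d → ℤ)) : Prop where
  measurable : ∀ k, Measurable (X k)
  indep : iIndepFun X μ
  prob_pos : ∀ k i, μ.real {ω | X k ω = Pi.single i 1} = 1 / (2 * (d : ℝ))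
  prob_neg : ∀ k i, μ.real {ω | X k ω = -Pi.single i 1} = 1 / (2 * (d : ℝ))

/-- The walk started at the origin: `S_n` is the sum of the first `n` steps. -/
def walk {Ω : Type*} {d : ℕ} (X : ℕ → Ω → (Fin d → ℤ)) (n : ℕ) (ω : Ω) : Fin d → ℤ :=
  ∑ k ∈ Finset.range n, X k ω

/-- The local time `ξ(x, n) = #{k : 0 < k ≤ n, S_k = x}`. -/
def localTime {Ω : Type*} {d : ℕ} (X : ℕ → Ω → (Fin d → ℤ)) (x : Fin d → ℤ) (n : ℕ) (ω : Ω) : ℕ :=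
  ((Finset.Icc 1 n).filter (fun k => walk X k ω = x)).card

/-- The maximal local time `ξ(n) = max_x ξ(x, n)`. The supremum is that of a family of natural
numbers bounded by `n`, so it is a maximum. -/
def maxLocalTime {Ω : Type*} {d : ℕ} (X : ℕ → Ω → (Fin d → ℤ)) (n : ℕ) (ω : Ω) : ℕ :=
  ⨆ x : Fin d → ℤ, localTime X x n ω

/-- `γ`: the probability that the walk never returns to its starting point. -/
def escapeProb {Ω : Type*} [MeasurableSpace Ω] {d : ℕ} (μ : Measure Ω)
    (X : ℕ → Ω → (Fin d → ℤ)) : ℝ :=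
  μ.real {ω | ∀ n : ℕ, 1 ≤ n → walk X n ω ≠ 0}

/-- `λ = -1 / log (1 - γ)`. -/
def lambdaConst {Ω : Type*} [MeasurableSpace Ω] {d : ℕ} (μ : Measure Ω)
    (X : ℕ → Ω → (Fin d → ℤ)) : ℝ :=
  -1 / Real.log (1 - escapeProb μ X)

/-- The local time at a site up to time `n` is at most `n`. -/
theorem localTime_le {Ω : Type*} {d : ℕ} (X : ℕ → Ω → (Fin d → ℤ)) (x : Fin d → ℤ) (n : ℕ)
    (ω : Ω) : localTime X x n ω ≤ n := by
  have h := Finset.card_filter_le (Finset.Icc 1 n) (fun k => walk X k ω = x)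
  simpa [localTime] using h

/-- The maximal local time is attained and dominates every local time. -/
theorem maxLocalTime_isGreatest {Ω : Type*} {d : ℕ} (X : ℕ → Ω → (Fin d → ℤ)) (n : ℕ) (ω : Ω) :
    IsGreatest (Set.range fun x => localTime X x n ω) (maxLocalTime X n ω) := by
  have hb : BddAbove (Set.range fun x => localTime X x n ω) :=
    ⟨n, by rintro _ ⟨x, rfl⟩; exact localTime_le X x n ω⟩
  exact ⟨Nat.sSup_mem (Set.range_nonempty _) hb, fun _ h => le_csSup hb h⟩

end

open Filter

/-! Put q = 1 - γ. In infinite time the origin is revisited at least k times with probability q^k.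
The heart of the proof is that time of order k² already suffices up to a constant: P(ξ(0, A k²) ≥ k)
≥ q^k / 4 (`exists_le_measureReal_le_localTime`). Fourier inversion bounds P(S_n = 0), hence the
first-return probabilities, by C n^(-3/2). An excursion truncated at length m thus loses mass
O(m^(-1/2)) and has mean length O(m^(1/2)). With m of order k², the k-th power of the truncated mass
is still comparable with q^k, and k excursions last O(k²) on average (`exists_renewal_lower_bound`).

Time 2^j contains about 2^j / (A k²) disjoint blocks of length A k², and each independently gives
its own starting point k further visits with probability at least q^k / 4
(`measureReal_maxLocalTime_lt_le`). For k near λ (log 2^(j+1) - (2 + ε) log log 2^j), q^k is of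
order j^(2+ε) / 2^j while k² is O(j²), so all blocks fail with probability at most exp(-c j^ε). The
2 in the theorem is thus the exponent in k². Borel–Cantelli along powers of two and monotonicity of
ξ finish the proof. -/

/-! ### The law of a single step. -/

/-- The unit vectors `e_i` (for `b = true`) and `-e_i` (for `b = false`). -/
def unitStep {d : ℕ} (p : Fin d × Bool) : Fin d → ℤ :=
  if p.2 then Pi.single p.1 1 else -Pi.single p.1 1

theorem unitStep_injective {d : ℕ} : Function.Injective (unitStep (d := d)) := by
  rintro ⟨i, b⟩ ⟨j, c⟩ h
  have hi := congrFun h i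
  have hj := congrFun h j
  by_cases hij : i = j
  · subst hij
    cases b <;> cases c <;> simp [unitStep] at hi ⊢
  · cases b <;> cases c <;> simp [unitStep, hij] at hi

namespace IsSimpleRandomWalkSteps

variable {Ω : Type*} [MeasurableSpace Ω] {d : ℕ} {μ : Measure Ω} {X : ℕ → Ω → (Fin d → ℤ)}

theorem measureReal_eq_unitStep (hX : IsSimpleRandomWalkSteps d μ X) (k : ℕ) (p : Fin d × Bool) :
    μ.real {ω | X k ω = unitStep p} = 1 / (2 * (d : ℝ)) := by
  obtain ⟨i, b⟩ := p
  cases b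
  · simpa [unitStep] using hX.prob_neg k i
  · simpa [unitStep] using hX.prob_pos k i

variable [IsProbabilityMeasure μ]

/-- The 2d prescribed probabilities belong to disjoint events and add up to 1, so no mass is left
for other values. -/
theorem ae_mem_range_unitStep (hX : IsSimpleRandomWalkSteps d μ X) (hd : d ≠ 0) (k : ℕ) :
    ∀ᵐ ω ∂μ, ∃ p, X k ω = unitStep p := by
  have hmeas : ∀ p, MeasurableSet {ω | X k ω = unitStep p} := fun p =>
    hX.measurable k (measurableSet_singleton _)
  have hset : {ω | ∃ p, X k ω = unitStep p} = ⋃ p, {ω | X k ω = unitStep p} := by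
    ext ω; simp
  have hdisj : Pairwise (Function.onFun Disjoint fun p => {ω | X k ω = unitStep p}) := by
    intro p p' hne
    refine Set.disjoint_left.2 fun ω h h' => hne (unitStep_injective ?_)
    exact h.symm.trans h'
  have h1 : μ.real {ω | ∃ p, X k ω = unitStep p} = 1 := by
    rw [hset, measureReal_iUnion_fintype hdisj hmeas]
    simp only [hX.measureReal_eq_unitStep, Finset.sum_const, Finset.card_univ, Fintype.card_prod,
      Fintype.card_fin, Fintype.card_bool, nsmul_eq_mul]
    have : (d : ℝ) ≠ 0 := by exact_mod_cast hd
    push_cast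
    field_simp
  have hm : MeasurableSet {ω | ∃ p, X k ω = unitStep p} := by
    rw [hset]; exact .iUnion hmeas
  refine (mem_ae_iff_prob_eq_one hm).2 ?_
  rwa [measureReal_def, ENNReal.toReal_eq_one_iff] at h1

theorem identDistrib (hX : IsSimpleRandomWalkSteps d μ X) (hd : d ≠ 0) (j k : ℕ) :
    IdentDistrib (X j) (X k) μ μ := by
  refine ⟨(hX.measurable j).aemeasurable, (hX.measurable k).aemeasurable, ?_⟩
  refine Measure.ext_of_singleton fun v => ?_
  rw [Measure.map_apply (hX.measurable j) (measurableSet_singleton _),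
    Measure.map_apply (hX.measurable k) (measurableSet_singleton _)]
  by_cases hv : ∃ p, v = unitStep p
  · obtain ⟨p, rfl⟩ := hv
    have h := (hX.measureReal_eq_unitStep j p).trans (hX.measureReal_eq_unitStep k p).symm
    exact (measureReal_eq_measureReal_iff).1 h
  · have h0 : ∀ l, μ (X l ⁻¹' {v}) = 0 := fun l => by
      have h := hX.ae_mem_range_unitStep hd l
      rw [ae_iff] at h
      refine measure_mono_null ?_ h
      rintro ω rfl
      exact hv
    rw [h0, h0]

theorem integral_comp_eq_sum (hX : IsSimpleRandomWalkSteps d μ X) (hd : d ≠ 0) (k : ℕ)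
    (g : (Fin d → ℤ) → ℂ) :
    ∫ ω, g (X k ω) ∂μ = ∑ p : Fin d × Bool, (1 / (2 * (d : ℝ)) : ℝ) • g (unitStep p) := by
  have hm : ∀ p, MeasurableSet {ω | X k ω = unitStep p} := fun p =>
    hX.measurable k (measurableSet_singleton _)
  have h : (fun ω => g (X k ω)) =ᵐ[μ] fun ω =>
      ∑ p : Fin d × Bool, {ω | X k ω = unitStep p}.indicator (fun _ => g (unitStep p)) ω := by
    filter_upwards [hX.ae_mem_range_unitStep hd k] with ω ⟨p, hp⟩
    rw [Finset.sum_eq_single p]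
    · simp [hp]
    · intro p' _ hne
      rw [Set.indicator_of_notMem]
      simp only [Set.mem_ofPred_eq, hp]
      exact fun h => hne (unitStep_injective h.symm)
    · simp
  rw [integral_congr_ae h, integral_finsetSum]
  · refine Finset.sum_congr rfl fun p _ => ?_
    rw [integral_indicator (hm p), setIntegral_const, hX.measureReal_eq_unitStep]
  · intro p _
    exact (integrable_const _).indicator (hm p)

end IsSimpleRandomWalkSteps

/-! ### Characters of the lattice and Gaussian bounds. -/

/-- The character `v ↦ e^{i θ · v}` of `ℤ^d`, written as a product over the coordinates. -/
noncomputable def latticeChar {d : ℕ} (θ : Fin d → ℝ) (v : Fin d → ℤ) : ℂ :=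
  ∏ j, Complex.exp (v j * Complex.I * θ j)

theorem latticeChar_zero {d : ℕ} (θ : Fin d → ℝ) : latticeChar θ 0 = 1 := by
  simp [latticeChar]

theorem latticeChar_add {d : ℕ} (θ : Fin d → ℝ) (v w : Fin d → ℤ) :
    latticeChar θ (v + w) = latticeChar θ v * latticeChar θ w := by
  simp only [latticeChar, ← Finset.prod_mul_distrib, ← Complex.exp_add]
  refine Finset.prod_congr rfl fun j _ => ?_
  congr 1
  push_cast [Pi.add_apply]
  ring

theorem latticeChar_sum {d : ℕ} {ι : Type*} (θ : Fin d → ℝ) (s : Finset ι) (v : ι → Fin d → ℤ) :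
    latticeChar θ (∑ k ∈ s, v k) = ∏ k ∈ s, latticeChar θ (v k) := by
  classical
  induction s using Finset.induction_on with
  | empty => simp [latticeChar_zero]
  | insert a s ha ih => rw [Finset.sum_insert ha, Finset.prod_insert ha, latticeChar_add, ih]

theorem norm_latticeChar {d : ℕ} (θ : Fin d → ℝ) (v : Fin d → ℤ) : ‖latticeChar θ v‖ = 1 := by
  rw [latticeChar, norm_prod]
  refine Finset.prod_eq_one fun j _ => ?_
  have : (v j * Complex.I * θ j : ℂ) = ((v j * θ j : ℝ) : ℂ) * Complex.I := by push_cast; ring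
  rw [this, Complex.norm_exp_ofReal_mul_I]

theorem latticeChar_single {d : ℕ} (θ : Fin d → ℝ) (i : Fin d) (a : ℤ) :
    latticeChar θ (Pi.single i a) = Complex.exp (a * Complex.I * θ i) := by
  rw [latticeChar, Finset.prod_eq_single i]
  · simp
  · intro j _ hj
    simp [hj]
  · simp

/-- The average of the cosines of the coordinates: the characteristic function of a step. -/
noncomputable def stepCharFun {d : ℕ} (θ : Fin d → ℝ) : ℝ := (∑ i, Real.cos (θ i)) / d

/-- Equivalent to (1 - |cos x|)² ≥ 0. The sine vanishes at both 0 and π, so one bound covers all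
points where |cos| = 1, including those due to the parity of the walk. -/
theorem abs_cos_le_one_sub_sin_sq (x : ℝ) : |Real.cos x| ≤ 1 - Real.sin x ^ 2 / 2 := by
  have h := Real.sin_sq_add_cos_sq x
  rw [← sq_abs (Real.cos x)] at h
  nlinarith [sq_nonneg (1 - |Real.cos x|)]

/-- The product form lets the integral over the torus factor into d equal one-dimensional integrals.
-/
theorem abs_stepCharFun_pow_le {d : ℕ} (hd : d ≠ 0) (θ : Fin d → ℝ) (n : ℕ) :
    |stepCharFun θ| ^ n ≤ ∏ i, Real.exp (-(n / (2 * d)) * Real.sin (θ i) ^ 2) := by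
  have hd' : (0 : ℝ) < d := by exact_mod_cast Nat.pos_of_ne_zero hd
  have h1 : |stepCharFun θ| ≤ Real.exp (-(∑ i, Real.sin (θ i) ^ 2) / (2 * d)) := by
    calc |stepCharFun θ| = |∑ i, Real.cos (θ i)| / d := by
          rw [stepCharFun, abs_div, abs_of_pos hd']
      _ ≤ (∑ i, (1 - Real.sin (θ i) ^ 2 / 2)) / d := by
          gcongr
          exact (Finset.abs_sum_le_sum_abs _ _).trans
            (Finset.sum_le_sum fun i _ => abs_cos_le_one_sub_sin_sq _)
      _ = -(∑ i, Real.sin (θ i) ^ 2) / (2 * d) + 1 := by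
          rw [Finset.sum_sub_distrib, ← Finset.sum_div]
          simp
          field_simp
          ring
      _ ≤ _ := Real.add_one_le_exp _
  calc |stepCharFun θ| ^ n ≤ Real.exp (-(∑ i, Real.sin (θ i) ^ 2) / (2 * d)) ^ n := by gcongr
    _ = _ := by
      rw [← Real.exp_nat_mul, ← Real.exp_sum, ← Finset.mul_sum]
      congr 1
      ring

theorem integral_latticeChar {d : ℕ} (v : Fin d → ℤ) :
    ∫ θ, latticeChar θ v ∂(Measure.pi fun _ => volume.restrict (Set.Ioc (-Real.pi) Real.pi)) =
      if v = 0 then (2 * Real.pi : ℂ) ^ d else 0 := by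
  unfold latticeChar
  rw [integral_fintype_prod_eq_prod (f := fun j (t : ℝ) => Complex.exp (v j * Complex.I * t))]
  have hpi : -Real.pi ≤ Real.pi := by linarith [Real.pi_pos]
  have h : ∀ j, ∫ t in Set.Ioc (-Real.pi) Real.pi, Complex.exp (v j * Complex.I * (t : ℝ)) =
      if v j = 0 then (2 * Real.pi : ℂ) else 0 := by
    intro j
    rw [← intervalIntegral.integral_of_le hpi]
    split_ifs with hj
    · simp [hj, two_mul]
    · rw [integral_exp_mul_complex (by simp [hj])]
      have : Complex.exp (v j * Complex.I * (Real.pi : ℝ)) =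
          Complex.exp (v j * Complex.I * ((-Real.pi : ℝ) : ℂ)) := by
        rw [Complex.exp_eq_exp_iff_exists_int]
        exact ⟨v j, by push_cast; ring⟩
      rw [this, sub_self, zero_div]
  simp only [h]
  split_ifs with hv
  · simp [hv]
  · obtain ⟨j, hj⟩ := Function.ne_iff.1 hv
    exact Finset.prod_eq_zero (Finset.mem_univ j) (by simpa using hj)

/-- Jordan's inequality |sin y| ≥ 2|y|/π holds near each zero of the sine; the three Gaussians are
centred at 0, π and -π. -/
theorem exp_neg_mul_sin_sq_le {c x : ℝ} (hc : 0 ≤ c) (hx : x ∈ Set.Ioc (-Real.pi) Real.pi) :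
    Real.exp (-c * Real.sin x ^ 2) ≤ Real.exp (-(4 * c / Real.pi ^ 2) * x ^ 2) +
      Real.exp (-(4 * c / Real.pi ^ 2) * (x - Real.pi) ^ 2) +
      Real.exp (-(4 * c / Real.pi ^ 2) * (x + Real.pi) ^ 2) := by
  have key : ∀ y, |y| ≤ Real.pi / 2 →
      Real.exp (-c * Real.sin y ^ 2) ≤ Real.exp (-(4 * c / Real.pi ^ 2) * y ^ 2) := by
    intro y hy
    have h := Real.mul_abs_le_abs_sin hy
    have h2 : (2 / Real.pi * |y|) ^ 2 ≤ |Real.sin y| ^ 2 := by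
      have := Real.pi_pos
      gcongr
    rw [sq_abs, mul_pow, sq_abs] at h2
    have h3 := mul_le_mul_of_nonneg_left h2 hc
    refine Real.exp_le_exp.2 ?_
    have : 4 * c / Real.pi ^ 2 * y ^ 2 = c * ((2 / Real.pi) ^ 2 * y ^ 2) := by ring
    linarith
  have p1 := Real.exp_pos (-(4 * c / Real.pi ^ 2) * x ^ 2)
  have p2 := Real.exp_pos (-(4 * c / Real.pi ^ 2) * (x - Real.pi) ^ 2)
  have p3 := Real.exp_pos (-(4 * c / Real.pi ^ 2) * (x + Real.pi) ^ 2)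
  obtain ⟨h1, h2⟩ := hx
  by_cases ha : Real.pi / 2 < x
  · have := key (x - Real.pi) (abs_le.2 ⟨by linarith, by linarith⟩)
    rw [Real.sin_sub_pi, neg_sq] at this
    linarith
  by_cases hb : x < -(Real.pi / 2)
  · have := key (x + Real.pi) (abs_le.2 ⟨by linarith, by linarith⟩)
    rw [Real.sin_add_pi, neg_sq] at this
    linarith
  · have := key x (abs_le.2 ⟨by linarith, by linarith⟩)
    linarith

theorem setIntegral_exp_neg_mul_sin_sq_le {c : ℝ} (hc : 0 < c) :
    ∫ x in Set.Ioc (-Real.pi) Real.pi, Real.exp (-c * Real.sin x ^ 2) ≤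
      3 * √(Real.pi ^ 3 / (4 * c)) := by
  have hpi := Real.pi_pos
  have hb : 0 < 4 * c / Real.pi ^ 2 := by positivity
  have i1 := integrable_exp_neg_mul_sq hb
  have i2 := i1.comp_sub_right Real.pi
  have i3 := i1.comp_add_right Real.pi
  have i12 : Integrable fun x => Real.exp (-(4 * c / Real.pi ^ 2) * x ^ 2) +
      Real.exp (-(4 * c / Real.pi ^ 2) * (x - Real.pi) ^ 2) := i1.add i2
  have hF := i12.add i3
  calc ∫ x in Set.Ioc (-Real.pi) Real.pi, Real.exp (-c * Real.sin x ^ 2)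
      ≤ ∫ x in Set.Ioc (-Real.pi) Real.pi, (Real.exp (-(4 * c / Real.pi ^ 2) * x ^ 2) +
      Real.exp (-(4 * c / Real.pi ^ 2) * (x - Real.pi) ^ 2) +
      Real.exp (-(4 * c / Real.pi ^ 2) * (x + Real.pi) ^ 2)) := by
        refine setIntegral_mono_on ?_ hF.integrableOn measurableSet_Ioc
          fun x hx => exp_neg_mul_sin_sq_le hc.le hx
        exact (Continuous.integrableOn_Icc (by fun_prop)).mono_set Set.Ioc_subset_Icc_self
    _ ≤ ∫ x, (Real.exp (-(4 * c / Real.pi ^ 2) * x ^ 2) +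
      Real.exp (-(4 * c / Real.pi ^ 2) * (x - Real.pi) ^ 2) +
      Real.exp (-(4 * c / Real.pi ^ 2) * (x + Real.pi) ^ 2)) :=
        setIntegral_le_integral hF (Filter.Eventually.of_forall fun x => by positivity)
    _ = 3 * √(Real.pi / (4 * c / Real.pi ^ 2)) := by
        rw [integral_add i12 i3, integral_add i1 i2,
          integral_sub_right_eq_self (fun x => Real.exp (-(4 * c / Real.pi ^ 2) * x ^ 2)),
          integral_add_right_eq_self (fun x => Real.exp (-(4 * c / Real.pi ^ 2) * x ^ 2)),
          integral_gaussian]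
        ring
    _ = _ := by
        congr 2
        field_simp

/-! ### Fourier inversion and the decay of return probabilities. -/

namespace IsSimpleRandomWalkSteps

variable {Ω : Type*} [MeasurableSpace Ω] {d : ℕ} {μ : Measure Ω} {X : ℕ → Ω → (Fin d → ℤ)}

theorem measurable_walk (hX : IsSimpleRandomWalkSteps d μ X) (n : ℕ) : Measurable (walk X n) :=
  Finset.measurable_fun_sum _ fun k _ => hX.measurable k

variable [IsProbabilityMeasure μ]

theorem integral_latticeChar_step (hX : IsSimpleRandomWalkSteps d μ X) (hd : d ≠ 0) (k : ℕ)
    (θ : Fin d → ℝ) : ∫ ω, latticeChar θ (X k ω) ∂μ = stepCharFun θ := by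
  have hneg : ∀ i, latticeChar θ (-Pi.single i 1) = Complex.exp (-(Complex.I * θ i)) := fun i => by
    rw [← Pi.single_neg, latticeChar_single]
    push_cast
    congr 1
    ring
  rw [hX.integral_comp_eq_sum hd, Fintype.sum_prod_type]
  simp only [Fintype.sum_bool, unitStep, if_true, Bool.false_eq_true, if_false, hneg,
    latticeChar_single]
  rw [stepCharFun, Complex.ofReal_div, Complex.ofReal_sum, Finset.sum_div]
  refine Finset.sum_congr rfl fun i _ => ?_
  rw [Complex.ofReal_cos, Complex.cos, Complex.real_smul, Complex.real_smul]
  have hd' : (d : ℂ) ≠ 0 := by exact_mod_cast hd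
  push_cast
  have h1 : (1 : ℂ) * Complex.I * θ i = θ i * Complex.I := by ring
  have h2 : -(Complex.I * θ i : ℂ) = -θ i * Complex.I := by ring
  rw [h1, h2]
  field_simp

theorem integral_latticeChar_walk (hX : IsSimpleRandomWalkSteps d μ X) (hd : d ≠ 0) (n : ℕ)
    (θ : Fin d → ℝ) : ∫ ω, latticeChar θ (walk X n ω) ∂μ = (stepCharFun θ : ℂ) ^ n := by
  have hind : iIndepFun (fun i : Fin n => X i) μ := hX.indep.precomp Fin.val_injective
  have h := hind.integral_fun_prod_comp (f := fun _ => latticeChar θ)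
    (fun i => (hX.measurable i).aemeasurable)
    (fun i => (measurable_of_countable _).aestronglyMeasurable)
  simp only [hX.integral_latticeChar_step hd, Finset.prod_const, Finset.card_univ,
    Fintype.card_fin] at h
  rw [← h]
  refine integral_congr_ae (Filter.Eventually.of_forall fun ω => ?_)
  simp only [walk, latticeChar_sum]
  exact Finset.prod_range fun k => latticeChar θ (X k ω)

theorem measureReal_walk_eq_zero_eq_integral (hX : IsSimpleRandomWalkSteps d μ X) (hd : d ≠ 0)
    (n : ℕ) : (2 * Real.pi : ℂ) ^ d * μ.real {ω | walk X n ω = 0} =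
      ∫ θ, (stepCharFun θ : ℂ) ^ n
        ∂(Measure.pi fun _ : Fin d => volume.restrict (Set.Ioc (-Real.pi) Real.pi)) := by
  have hm : MeasurableSet {ω | walk X n ω = 0} := hX.measurable_walk n (measurableSet_singleton _)
  simp_rw [← hX.integral_latticeChar_walk hd n]
  rw [integral_integral_swap]
  · simp only [integral_latticeChar]
    have : (fun ω => if walk X n ω = 0 then (2 * Real.pi : ℂ) ^ d else 0) =
        {ω | walk X n ω = 0}.indicator fun _ => (2 * Real.pi : ℂ) ^ d := by
      ext ω
      simp [Set.indicator_apply]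
    rw [this, integral_indicator hm, setIntegral_const, Complex.real_smul, mul_comm]
  · refine Integrable.of_bound (C := 1) ?_
      (Filter.Eventually.of_forall fun p => (norm_latticeChar _ _).le)
    refine Measurable.aestronglyMeasurable ?_
    unfold Function.uncurry latticeChar
    refine Finset.measurable_fun_prod _ fun j _ => ?_
    have h1 : Measurable fun a : (Fin d → ℝ) × Ω => ((walk X n a.2 j : ℤ) : ℂ) :=
      (measurable_of_countable fun z : ℤ => (z : ℂ)).comp
        ((measurable_pi_apply j).comp ((hX.measurable_walk n).comp measurable_snd))
    have h2 : Measurable fun a : (Fin d → ℝ) × Ω => ((a.1 j : ℝ) : ℂ) := by fun_prop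
    exact Complex.measurable_exp.comp ((h1.mul_const _).mul h2)

theorem exists_measureReal_walk_eq_zero_le (hX : IsSimpleRandomWalkSteps d μ X) (hd : 3 ≤ d) :
    ∃ C : ℝ, 0 < C ∧ ∀ n : ℕ, 0 < n → μ.real {ω | walk X n ω = 0} ≤ C / (n * √n) := by
  have hd0 : d ≠ 0 := by omega
  have hd' : (0 : ℝ) < d := by exact_mod_cast Nat.pos_of_ne_zero hd0
  have hpi := Real.pi_pos
  refine ⟨(3 * √(Real.pi ^ 3 * d / 2)) ^ 3, by positivity, fun n hn => ?_⟩
  have hn' : (0 : ℝ) < n := by exact_mod_cast hn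
  set P := μ.real {ω | walk X n ω = 0} with hP
  have hP1 : P ≤ 1 := measureReal_le_one
  set ρ := Measure.pi fun _ : Fin d => volume.restrict (Set.Ioc (-Real.pi) Real.pi) with hρ
  have h1 : (2 * Real.pi) ^ d * P ≤ (3 * √(Real.pi ^ 3 / (4 * (n / (2 * d))))) ^ d := by
    calc (2 * Real.pi) ^ d * P = ‖(2 * Real.pi : ℂ) ^ d * P‖ := by
          rw [norm_mul, norm_pow, norm_mul, Complex.norm_real, Complex.norm_real,
            Real.norm_of_nonneg hpi.le, Real.norm_of_nonneg measureReal_nonneg]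
          simp [hP]
      _ ≤ ∫ θ, ∏ i, Real.exp (-(n / (2 * d)) * Real.sin (θ i) ^ 2) ∂ρ := by
          rw [hP, hX.measureReal_walk_eq_zero_eq_integral hd0 n]
          refine norm_integral_le_of_norm_le ?_ (Filter.Eventually.of_forall fun θ => ?_)
          · refine Integrable.of_bound (C := 1)
              (Continuous.aestronglyMeasurable (by fun_prop))
              (Filter.Eventually.of_forall fun θ => ?_)
            rw [norm_prod]
            refine Finset.prod_le_one (fun _ _ => norm_nonneg _) fun i _ => ?_
            rw [Real.norm_of_nonneg (Real.exp_nonneg _), Real.exp_le_one_iff, neg_mul]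
            exact neg_nonpos.2 (by positivity)
          · rw [norm_pow, Complex.norm_real]
            exact abs_stepCharFun_pow_le hd0 θ n
      _ = (∫ x in Set.Ioc (-Real.pi) Real.pi,
            Real.exp (-(n / (2 * d)) * Real.sin x ^ 2)) ^ d := by
          rw [hρ, integral_fintype_prod_eq_pow
            (f := fun x : ℝ => Real.exp (-(n / (2 * d)) * Real.sin x ^ 2)), Fintype.card_fin]
      _ ≤ _ := by
          refine pow_le_pow_left₀ ?_ (setIntegral_exp_neg_mul_sin_sq_le (by positivity)) d
          exact integral_nonneg fun x => (Real.exp_pos _).le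
  set K := 3 * √(Real.pi ^ 3 * d / 2) with hK
  have hKn : 3 * √(Real.pi ^ 3 / (4 * (n / (2 * d)))) = K / √n := by
    rw [hK, mul_div_assoc, ← Real.sqrt_div' _ hn'.le]
    congr 2
    field_simp
    ring
  rw [hKn] at h1
  have h2 : P ≤ (K / √n) ^ d := by
    refine le_trans ?_ h1
    refine le_mul_of_one_le_left measureReal_nonneg (one_le_pow₀ ?_)
    linarith [Real.pi_gt_three]
  have h0 : 0 ≤ K / √n := by positivity
  -- Lowering the exponent from d to 3 needs a base at most 1; otherwise the trivial bound P ≤ 1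
  -- suffices.
  have h3 : P ≤ (K / √n) ^ 3 := by
    rcases le_total (K / √n) 1 with h | h
    · exact h2.trans (pow_le_pow_of_le_one h0 h hd)
    · exact hP1.trans (one_le_pow₀ h)
  refine h3.trans_eq ?_
  rw [div_pow, pow_succ (√(n : ℝ)) 2, Real.sq_sqrt hn'.le]

end IsSimpleRandomWalkSteps

/-! ### Path decompositions and first returns. -/

section WalkPaths

variable {Ω : Type*} {d : ℕ} {X : ℕ → Ω → (Fin d → ℤ)}

theorem walk_add (j n : ℕ) (ω : Ω) :
    walk X (j + n) ω = walk X j ω + walk (fun i => X (j + i)) n ω := by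
  simp [walk, Finset.sum_range_add]

theorem localTime_eq_sum (x : Fin d → ℤ) (n : ℕ) (ω : Ω) :
    localTime X x n ω = ∑ k ∈ Finset.Icc 1 n, if walk X k ω = x then 1 else 0 := by
  rw [localTime, Finset.card_filter]

theorem localTime_le_maxLocalTime (x : Fin d → ℤ) (n : ℕ) (ω : Ω) :
    localTime X x n ω ≤ maxLocalTime X n ω :=
  (maxLocalTime_isGreatest X n ω).2 ⟨x, rfl⟩

theorem localTime_mono (x : Fin d → ℤ) {m n : ℕ} (h : m ≤ n) (ω : Ω) :
    localTime X x m ω ≤ localTime X x n ω :=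
  Finset.card_le_card (Finset.filter_subset_filter _ (Finset.Icc_subset_Icc_right h))

theorem maxLocalTime_mono {m n : ℕ} (h : m ≤ n) (ω : Ω) :
    maxLocalTime X m ω ≤ maxLocalTime X n ω := by
  obtain ⟨x, hx⟩ := (maxLocalTime_isGreatest X m ω).1
  rw [← hx]
  exact (localTime_mono x h ω).trans (localTime_le_maxLocalTime x n ω)

theorem map_filter_shift_subset (x : Fin d → ℤ) (j m : ℕ) (ω : Ω) :
    ((Finset.Icc 1 m).filter fun k => walk (fun i => X (j + i)) k ω = x).map (addLeftEmbedding j) ⊆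
      (Finset.Icc (j + 1) (j + m)).filter fun k => walk X k ω = walk X j ω + x := by
  intro k hk
  simp only [Finset.mem_map, Finset.mem_filter, Finset.mem_Icc, addLeftEmbedding_apply] at hk ⊢
  obtain ⟨i, ⟨⟨h1, h2⟩, h3⟩, rfl⟩ := hk
  exact ⟨⟨by omega, by omega⟩, by rw [walk_add, h3]⟩

theorem localTime_shift_le (x : Fin d → ℤ) (j m : ℕ) (ω : Ω) :
    localTime (fun i => X (j + i)) x m ω ≤ localTime X (walk X j ω + x) (j + m) ω := by
  have h := Finset.card_le_card (map_filter_shift_subset (X := X) x j m ω)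
  rw [Finset.card_map] at h
  exact h.trans (Finset.card_le_card
    (Finset.filter_subset_filter _ (Finset.Icc_subset_Icc_left (by omega))))

/-- The inequality is strict because the visit at time j is not counted by the shifted walk. -/
theorem localTime_shift_zero_lt {j : ℕ} (hj : 0 < j) (m : ℕ) {ω : Ω} (h0 : walk X j ω = 0) :
    localTime (fun i => X (j + i)) 0 m ω < localTime X 0 (j + m) ω := by
  have h := Finset.card_le_card (map_filter_shift_subset (X := X) 0 j m ω)
  rw [Finset.card_map, h0, zero_add] at h
  refine h.trans_lt (Finset.card_lt_card ?_)
  refine (Finset.ssubset_iff_of_subset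
    (Finset.filter_subset_filter _ (Finset.Icc_subset_Icc_left (by omega)))).2 ⟨j, ?_, ?_⟩
  · simp [h0]
    omega
  · simp

/-- The event that the walk returns to the origin for the first time at time `j`. -/
def firstReturn (X : ℕ → Ω → (Fin d → ℤ)) (j : ℕ) : Set Ω :=
  {ω | walk X j ω = 0 ∧ ∀ n ∈ Finset.Ico 1 j, walk X n ω ≠ 0}

theorem disjoint_firstReturn {i j : ℕ} (hi : 0 < i) (hj : 0 < j) (h : i ≠ j) :
    Disjoint (firstReturn X i) (firstReturn X j) := by
  refine Set.disjoint_left.2 fun ω h1 h2 => ?_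
  rcases lt_or_gt_of_ne h with h | h
  · exact h2.2 i (by simp; omega) h1.1
  · exact h1.2 j (by simp; omega) h2.1

theorem iUnion_firstReturn : ⋃ j : ℕ, firstReturn X (j + 1) =
    {ω | ∀ n : ℕ, 1 ≤ n → walk X n ω ≠ 0}ᶜ := by
  ext ω
  simp only [Set.mem_iUnion, Set.mem_compl_iff, Set.mem_ofPred_eq, not_forall, ne_eq, not_not]
  constructor
  · rintro ⟨j, hj⟩
    exact ⟨j + 1, by omega, hj.1⟩
  · rintro ⟨n, hn, h0⟩
    classical
    have hex : ∃ n, 1 ≤ n ∧ walk X n ω = 0 := ⟨n, hn, h0⟩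
    have hs := Nat.find_spec hex
    refine ⟨Nat.find hex - 1, ?_⟩
    rw [Nat.sub_add_cancel hs.1]
    refine ⟨hs.2, fun i hi h => ?_⟩
    rw [Finset.mem_Ico] at hi
    exact Nat.find_min hex hi.2 ⟨hi.1, h⟩

theorem measurable_localTime [MeasurableSpace Ω] (x : Fin d → ℤ) {l : ℕ}
    (h : ∀ n ≤ l, Measurable (walk X n)) : Measurable (localTime X x l) := by
  have : localTime X x l = fun ω => ∑ k ∈ Finset.Icc 1 l, if walk X k ω = x then 1 else 0 :=
    funext fun ω => localTime_eq_sum x l ω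
  rw [this]
  refine Finset.measurable_fun_sum _ fun k hk => ?_
  rw [Finset.mem_Icc] at hk
  exact Measurable.ite (h k hk.2 (measurableSet_singleton x)) measurable_const measurable_const

theorem measurableSet_firstReturn [MeasurableSpace Ω] {j : ℕ}
    (h : ∀ n ≤ j, Measurable (walk X n)) : MeasurableSet (firstReturn X j) := by
  have : firstReturn X j =
      walk X j ⁻¹' {0} ∩ ⋂ n ∈ Finset.Ico 1 j, walk X n ⁻¹' {0}ᶜ := by
    ext ω
    simp [firstReturn]
  rw [this]
  refine (h j le_rfl (measurableSet_singleton _)).inter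
    (Finset.measurableSet_biInter _ fun n hn => ?_)
  rw [Finset.mem_Ico] at hn
  exact h n hn.2.le (measurableSet_singleton _).compl

theorem measurable_walk_of_steps [MeasurableSpace Ω] {n : ℕ}
    (h : ∀ k < n, Measurable (X k)) : Measurable (walk X n) :=
  Finset.measurable_fun_sum _ fun k hk => h k (Finset.mem_range.1 hk)

end WalkPaths

/-! ### Independence of past and future, and independent blocks. -/

/-- The `σ`-algebra generated by the steps with index in `s`. -/
@[reducible] def stepSigma {Ω : Type*} {d : ℕ} (X : ℕ → Ω → (Fin d → ℤ)) (s : Set ℕ) :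
    MeasurableSpace Ω :=
  ⨆ i ∈ s, MeasurableSpace.comap (X i) inferInstance

theorem measurable_stepSigma {Ω : Type*} {d : ℕ} (X : ℕ → Ω → (Fin d → ℤ)) {s : Set ℕ} {k : ℕ}
    (hk : k ∈ s) : Measurable[stepSigma X s] (X k) := by
  rw [measurable_iff_comap_le]
  exact le_iSup₂_of_le k hk le_rfl

theorem measurableSet_le_localTime_shift {Ω : Type*} {d : ℕ} (X : ℕ → Ω → (Fin d → ℤ))
    (k j l : ℕ) {s : Set ℕ}
    (hs : ∀ i < l, j + i ∈ s) :
    MeasurableSet[stepSigma X s] {ω | k ≤ localTime (fun i => X (j + i)) 0 l ω} := by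
  let _ := stepSigma X s
  exact measurable_localTime 0 (fun n hn => measurable_walk_of_steps fun i hi =>
    measurable_stepSigma X (hs i (by omega))) measurableSet_Ici

namespace IsSimpleRandomWalkSteps

variable {Ω : Type*} [MeasurableSpace Ω] {d : ℕ} {μ : Measure Ω} {X : ℕ → Ω → (Fin d → ℤ)}

theorem shift (hX : IsSimpleRandomWalkSteps d μ X) (j : ℕ) :
    IsSimpleRandomWalkSteps d μ fun i => X (j + i) where
  measurable k := hX.measurable (j + k)
  indep := hX.indep.precomp (add_right_injective j)
  prob_pos k := hX.prob_pos (j + k)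
  prob_neg k := hX.prob_neg (j + k)

theorem indep_stepSigma (hX : IsSimpleRandomWalkSteps d μ X) (j : ℕ) :
    Indep (stepSigma X (Set.Iio j)) (stepSigma X (Set.Ici j)) μ :=
  indep_iSup_of_disjoint (fun i => (hX.measurable i).comap_le) hX.indep
    (Set.disjoint_left.2 fun _ h1 h2 => not_le.2 (Set.mem_Iio.1 h1) (Set.mem_Ici.1 h2))

theorem measurableSet_le_localTime (hX : IsSimpleRandomWalkSteps d μ X) (x : Fin d → ℤ)
    (k l : ℕ) : MeasurableSet {ω | k ≤ localTime X x l ω} :=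
  measurable_localTime x (fun n _ => hX.measurable_walk n) measurableSet_Ici

theorem measureReal_inter_shift (hX : IsSimpleRandomWalkSteps d μ X) {j : ℕ} {A : Set Ω}
    (hA : MeasurableSet[stepSigma X (Set.Iio j)] A) {B : Set Ω}
    (hB : MeasurableSet[stepSigma X (Set.Ici j)] B) :
    μ.real (A ∩ B) = μ.real A * μ.real B := by
  have h := (Indep_iff _ _ μ).1 (hX.indep_stepSigma j) A B hA hB
  rw [measureReal_def, h, ENNReal.toReal_mul, ← measureReal_def, ← measureReal_def]

variable [IsProbabilityMeasure μ]

theorem measureReal_le_localTime_shift (hX : IsSimpleRandomWalkSteps d μ X) (hd : d ≠ 0)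
    (k j l : ℕ) : μ.real {ω | k ≤ localTime (fun i => X (j + i)) 0 l ω} =
      μ.real {ω | k ≤ localTime X 0 l ω} := by
  have hid : IdentDistrib (fun ω i => X (j + i) ω) (fun ω i => X i ω) μ μ :=
    IdentDistrib.pi (fun i => hX.identDistrib hd (j + i) i) (hX.shift j).indep hX.indep
  have hm : MeasurableSet {x : ℕ → Fin d → ℤ | k ≤ localTime (fun i y => y i) 0 l x} :=
    measurable_localTime 0 (fun n _ => measurable_walk_of_steps fun i _ => measurable_pi_apply i)
      measurableSet_Ici
  have h := hid.measure_mem_eq hm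
  rw [measureReal_def, measureReal_def]
  exact congrArg ENNReal.toReal h

/-- Split according to the time of the first return: it counts as one visit, and the walk then
starts afresh, independently of its past. -/
theorem sum_firstReturn_mul_le (hX : IsSimpleRandomWalkSteps d μ X) (hd : d ≠ 0) (k l : ℕ) :
    ∑ j ∈ Finset.range l, μ.real (firstReturn X (j + 1)) *
      μ.real {ω | k ≤ localTime X 0 (l - (j + 1)) ω} ≤ μ.real {ω | k + 1 ≤ localTime X 0 l ω} := by
  set A : ℕ → Set Ω := fun j => firstReturn X (j + 1) ∩
    {ω | k ≤ localTime (fun i => X (j + 1 + i)) 0 (l - (j + 1)) ω} with hA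
  have hAm : ∀ j, MeasurableSet (A j) := fun j =>
    (measurableSet_firstReturn fun n _ => hX.measurable_walk n).inter
      ((hX.shift (j + 1)).measurableSet_le_localTime 0 _ _)
  have hAreal : ∀ j, μ.real (A j) = μ.real (firstReturn X (j + 1)) *
      μ.real {ω | k ≤ localTime X 0 (l - (j + 1)) ω} := fun j => by
    rw [← hX.measureReal_le_localTime_shift hd k (j + 1)]
    refine hX.measureReal_inter_shift (j := j + 1) ?_
      (measurableSet_le_localTime_shift X _ _ _ fun i _ => by simp)
    let _ := stepSigma X (Set.Iio (j + 1))
    exact measurableSet_firstReturn fun n hn => measurable_walk_of_steps fun i hi =>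
      measurable_stepSigma X (by simp; omega)
  simp_rw [← hAreal]
  rw [← measureReal_biUnion_finset _ fun j _ => hAm j]
  · refine measureReal_mono (Set.iUnion₂_subset fun j hj ω hω => ?_)
    rw [Finset.mem_range] at hj
    have h := localTime_shift_zero_lt (Nat.succ_pos j) (l - (j + 1)) hω.1.1
    rw [Nat.add_sub_cancel' (by omega : j + 1 ≤ l)] at h
    exact (Nat.succ_le_succ hω.2).trans h
  · intro i _ j _ hij
    exact (disjoint_firstReturn (Nat.succ_pos i) (Nat.succ_pos j) (by omega)).mono
      Set.inter_subset_left Set.inter_subset_left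

theorem hasSum_firstReturn (hX : IsSimpleRandomWalkSteps d μ X) :
    HasSum (fun j => μ.real (firstReturn X (j + 1))) (1 - escapeProb μ X) := by
  have hm : ∀ j, MeasurableSet (firstReturn X (j + 1)) := fun j =>
    measurableSet_firstReturn fun n _ => hX.measurable_walk n
  have hdisj : Pairwise (Function.onFun Disjoint fun j => firstReturn X (j + 1)) := fun i j hij =>
    disjoint_firstReturn (Nat.succ_pos i) (Nat.succ_pos j) (by omega)
  have hU : μ.real (⋃ j : ℕ, firstReturn X (j + 1)) = 1 - escapeProb μ X := by
    have hme : MeasurableSet {ω | ∀ n : ℕ, 1 ≤ n → walk X n ω ≠ 0} := by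
      rw [← compl_compl {ω | ∀ n : ℕ, 1 ≤ n → walk X n ω ≠ 0}, ← iUnion_firstReturn]
      exact (MeasurableSet.iUnion hm).compl
    rw [iUnion_firstReturn, probReal_compl_eq_one_sub hme]
    rfl
  rw [← hU, measureReal_def, measure_iUnion hdisj hm,
    ENNReal.tsum_toReal_eq fun j => measure_ne_top μ _]
  refine ENNReal.hasSum_toReal ?_
  rw [← measure_iUnion hdisj hm]
  exact measure_ne_top _ _

/-- In each of N disjoint blocks of length l, the visits to the block's own starting point depend
only on the steps of that block, so the N failures are independent. -/
theorem measureReal_maxLocalTime_lt_le (hX : IsSimpleRandomWalkSteps d μ X) (hd : d ≠ 0)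
    {k l N n : ℕ} (hn : N * l ≤ n) :
    μ.real {ω | maxLocalTime X n ω < k} ≤ (1 - μ.real {ω | k ≤ localTime X 0 l ω}) ^ N := by
  set E : ℕ → Set Ω := fun N =>
    ⋂ i ∈ Finset.range N, {ω | k ≤ localTime (fun t => X (i * l + t)) 0 l ω}ᶜ with hE
  have hEreal : ∀ N, μ.real (E N) = (1 - μ.real {ω | k ≤ localTime X 0 l ω}) ^ N := by
    intro N
    induction N with
    | zero => simp [hE]
    | succ N ih =>
      have hsucc : E (N + 1) = E N ∩ {ω | k ≤ localTime (fun t => X (N * l + t)) 0 l ω}ᶜ := by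
        simp only [hE, Finset.range_add_one, Finset.set_biInter_insert]
        rw [Set.inter_comm]
      rw [hsucc, hX.measureReal_inter_shift (j := N * l), ih, pow_succ,
        probReal_compl_eq_one_sub ((hX.shift (N * l)).measurableSet_le_localTime 0 _ _),
        hX.measureReal_le_localTime_shift hd]
      · refine Finset.measurableSet_biInter _ fun i hi => ?_
        refine (measurableSet_le_localTime_shift X _ _ _ fun t ht => ?_).compl
        rw [Finset.mem_range] at hi
        have : (i + 1) * l ≤ N * l := Nat.mul_le_mul_right l hi
        rw [Set.mem_Iio]
        linarith [add_mul i 1 l]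
      · exact (measurableSet_le_localTime_shift X _ _ _ fun i _ => by simp).compl
  rw [← hEreal]
  refine measureReal_mono fun ω hω => ?_
  simp only [hE, Set.mem_iInter, Set.mem_compl_iff, Set.mem_ofPred_eq, not_le, Finset.mem_range]
  intro i hi
  have hi' : i * l + l ≤ n := by
    have : (i + 1) * l ≤ N * l := Nat.mul_le_mul_right l hi
    linarith [add_mul i 1 l]
  calc localTime (fun t => X (i * l + t)) 0 l ω ≤ _ := localTime_shift_le 0 (i * l) l ω
    _ ≤ maxLocalTime X (i * l + l) ω := localTime_le_maxLocalTime _ _ ω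
    _ ≤ maxLocalTime X n ω := maxLocalTime_mono hi' ω
    _ < k := hω

theorem measureReal_firstReturn_le (j : ℕ) :
    μ.real (firstReturn X j) ≤ μ.real {ω | walk X j ω = 0} :=
  measureReal_mono fun _ h => h.1

end IsSimpleRandomWalkSteps

/-! ### Renewal estimates. -/

/-- A truncated first moment bound for defective renewal sequences. -/
theorem renewal_lower_bound {f : ℕ → ℝ} {p : ℕ → ℕ → ℝ} (hf : ∀ j, 0 ≤ f j)
    (hp : ∀ k l, 0 ≤ p k l) (hp0 : ∀ l, p 0 l = 1)
    (hrec : ∀ k l, ∑ j ∈ Finset.range l, f j * p k (l - (j + 1)) ≤ p (k + 1) l) (m D : ℕ)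
    (k l : ℕ) (hl : l ≤ D) :
    (∑ j ∈ Finset.range m, f j) ^ k * l -
      k * (∑ j ∈ Finset.range m, (j + 1) * f j) * (∑ j ∈ Finset.range m, f j) ^ (k - 1) ≤
        D * p k l := by
  set q := ∑ j ∈ Finset.range m, f j with hq
  set a := ∑ j ∈ Finset.range m, (j + 1) * f j with ha
  have hq0 : 0 ≤ q := Finset.sum_nonneg fun j _ => hf j
  have ha0 : 0 ≤ a := Finset.sum_nonneg fun j _ => mul_nonneg (by positivity) (hf j)
  -- The left side is affine in l and D stays fixed, so averaging over l - (j + 1) with weights f j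
  -- reproduces the same form with k + 1. For D = l it is Markov's inequality for the total length
  -- of k truncated excursions.
  induction k generalizing l with
  | zero => simpa [hp0] using hl
  | succ k ih =>
    have hterm : ∀ j ∈ Finset.range m,
        f j * (q ^ k * (l - (j + 1)) - k * a * q ^ (k - 1)) ≤
          if j < l then f j * (D * p k (l - (j + 1))) else 0 := by
      intro j _
      split_ifs with hj
      · refine mul_le_mul_of_nonneg_left ?_ (hf j)
        have := ih (l - (j + 1)) (by omega)
        rwa [Nat.cast_sub hj, Nat.cast_succ] at this
      -- Excursions longer than the remaining time contribute nonpositively and can be dropped.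
      · refine mul_nonpos_of_nonneg_of_nonpos (hf j) ?_
        have h1 : (l : ℝ) - (j + 1) ≤ 0 := by
          have : (l : ℝ) ≤ j := by exact_mod_cast not_lt.1 hj
          linarith
        have h2 := mul_nonpos_of_nonneg_of_nonpos (pow_nonneg hq0 k) h1
        have h3 : 0 ≤ k * a * q ^ (k - 1) := by positivity
        linarith
    have hsum : ∑ j ∈ Finset.range m, (if j < l then f j * (D * p k (l - (j + 1))) else 0) ≤
        D * p (k + 1) l := by
      calc _ = ∑ j ∈ (Finset.range m).filter (· < l), f j * (D * p k (l - (j + 1))) :=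
            (Finset.sum_filter _ _).symm
        _ ≤ ∑ j ∈ Finset.range l, f j * (D * p k (l - (j + 1))) := by
            refine Finset.sum_le_sum_of_subset_of_nonneg (fun j hj => ?_) fun j _ _ =>
              mul_nonneg (hf j) (mul_nonneg (Nat.cast_nonneg _) (hp _ _))
            exact Finset.mem_range.2 (Finset.mem_filter.1 hj).2
        _ = D * ∑ j ∈ Finset.range l, f j * p k (l - (j + 1)) := by
            rw [Finset.mul_sum]
            exact Finset.sum_congr rfl fun j _ => by ring
        _ ≤ _ := mul_le_mul_of_nonneg_left (hrec k l) (Nat.cast_nonneg _)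
    refine le_trans (le_of_eq ?_) ((Finset.sum_le_sum hterm).trans hsum)
    have hexp : ∑ j ∈ Finset.range m, f j * (q ^ k * (l - (j + 1)) - k * a * q ^ (k - 1)) =
        q ^ k * l * q - q ^ k * a - k * a * q ^ (k - 1) * q := by
      have hlin : ∀ u v : ℝ, ∑ j ∈ Finset.range m, f j * (u * (l - (j + 1)) - v) =
          u * l * q - u * a - v * q := fun u v => by
        rw [hq, ha, Finset.mul_sum, Finset.mul_sum, Finset.mul_sum, ← Finset.sum_sub_distrib,
          ← Finset.sum_sub_distrib]
        exact Finset.sum_congr rfl fun j _ => by ring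
      rw [hlin]
    rw [hexp, Nat.add_sub_cancel]
    have hk : (k : ℝ) * a * q ^ (k - 1) * q = k * a * q ^ k := by
      rcases k with _ | k
      · simp
      · rw [Nat.add_sub_cancel, pow_succ]; ring
    rw [hk]
    push_cast
    ring

theorem inv_sqrt_succ_le (j : ℕ) : 1 / √((j : ℝ) + 1) ≤ 2 * (√((j : ℝ) + 1) - √j) := by
  have h1 : 0 < √((j : ℝ) + 1) := by positivity
  rw [div_le_iff₀ h1]
  nlinarith [Real.sq_sqrt (by positivity : (0 : ℝ) ≤ (j : ℝ) + 1),
    Real.sq_sqrt (by positivity : (0 : ℝ) ≤ (j : ℝ)),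
    sq_nonneg (√((j : ℝ) + 1) - √j)]

theorem inv_mul_sqrt_succ_le {j : ℕ} (hj : 0 < j) :
    1 / (((j : ℝ) + 1) * √((j : ℝ) + 1)) ≤ 2 * (1 / √j - 1 / √((j : ℝ) + 1)) := by
  have hj' : (0 : ℝ) < j := by exact_mod_cast hj
  have h0 : 0 < √(j : ℝ) := by positivity
  have h1 : 0 < √((j : ℝ) + 1) := by positivity
  have e0 := Real.sq_sqrt hj'.le
  have e1 := Real.sq_sqrt (by positivity : (0 : ℝ) ≤ (j : ℝ) + 1)
  have hle : √(j : ℝ) ≤ √((j : ℝ) + 1) := Real.sqrt_le_sqrt (by linarith)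
  set s := √(j : ℝ)
  set t := √((j : ℝ) + 1)
  rw [← e1, div_sub_div _ _ h0.ne' h1.ne', ← mul_div_assoc, div_le_div_iff₀ (by positivity)
    (by positivity)]
  have h2 : t ^ 2 - s ^ 2 = 1 := by linarith
  have h3 : s ≤ 2 * (t - s) * t ^ 2 := by
    have h4 : 1 ≤ 2 * t * (t - s) := by nlinarith [sq_nonneg (t - s)]
    nlinarith
  nlinarith [mul_le_mul_of_nonneg_right h3 h1.le]

theorem sum_range_succ_mul_le {f : ℕ → ℝ} {C : ℝ} (hC : 0 ≤ C)
    (hfC : ∀ j : ℕ, f j ≤ C / (((j : ℝ) + 1) * √((j : ℝ) + 1))) (m : ℕ) :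
    ∑ j ∈ Finset.range m, ((j : ℝ) + 1) * f j ≤ 2 * C * √m := by
  induction m with
  | zero => simp
  | succ m ih =>
    rw [Finset.sum_range_succ]
    have h1 : ((m : ℝ) + 1) * f m ≤ C * (1 / √((m : ℝ) + 1)) := by
      refine (mul_le_mul_of_nonneg_left (hfC m) (by positivity)).trans_eq ?_
      field_simp
    have h2 := mul_le_mul_of_nonneg_left (inv_sqrt_succ_le m) hC
    push_cast
    linarith

theorem sub_sum_range_le {f : ℕ → ℝ} {C q : ℝ} (hC : 0 ≤ C)
    (hfC : ∀ j : ℕ, f j ≤ C / (((j : ℝ) + 1) * √((j : ℝ) + 1))) (hq : HasSum f q)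
    {m : ℕ} (hm : 0 < m) : q - ∑ j ∈ Finset.range m, f j ≤ 2 * C / √m := by
  have h : ∀ i, ∑ j ∈ Finset.range (m + i), f j ≤
      ∑ j ∈ Finset.range m, f j + 2 * C * (1 / √m - 1 / √((m + i : ℕ) : ℝ)) := by
    intro i
    induction i with
    | zero => simp
    | succ i ih =>
      rw [← add_assoc, Finset.sum_range_succ]
      have h1 := hfC (m + i)
      have h2 := mul_le_mul_of_nonneg_left (inv_mul_sqrt_succ_le (by omega : 0 < m + i)) hC
      rw [mul_one_div] at h2
      push_cast at h1 h2 ih ⊢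
      linarith
  have hlim : Tendsto (fun i => ∑ j ∈ Finset.range (m + i), f j) atTop (nhds q) := by
    simpa only [add_comm m] using (tendsto_add_atTop_iff_nat m).2 hq.tendsto_sum_nat
  rw [sub_le_iff_le_add']
  refine le_of_tendsto' hlim fun i => (h i).trans ?_
  have : 0 ≤ 2 * C * (1 / √((m + i : ℕ) : ℝ)) := by positivity
  rw [mul_sub, mul_one_div]
  linarith

/-- Truncating at m = (b k)² changes q by a relative error of at most 1/(2k), so by Bernoulli the
k-th power loses at most a factor 2. The truncated mean is O(k), so a horizon A k² with A large
makes the Markov error at most half of the main term. -/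
theorem exists_renewal_lower_bound {f : ℕ → ℝ} {p : ℕ → ℕ → ℝ} {C q : ℝ} (hC : 0 < C)
    (hf : ∀ j, 0 ≤ f j) (hfC : ∀ j : ℕ, f j ≤ C / (((j : ℝ) + 1) * √((j : ℝ) + 1)))
    (hsum : HasSum f q) (hq : 0 < q) (hp : ∀ k l, 0 ≤ p k l) (hp0 : ∀ l, p 0 l = 1)
    (hrec : ∀ k l, ∑ j ∈ Finset.range l, f j * p k (l - (j + 1)) ≤ p (k + 1) l) :
    ∃ A : ℕ, 0 < A ∧ ∀ k, 0 < k → q ^ k / 4 ≤ p k (A * k ^ 2) := by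
  -- Chosen so that the lost tail 2C/(b k) is at most q/(2k).
  obtain ⟨b, hb⟩ := exists_nat_gt (4 * C / q)
  have hb0 : (0 : ℝ) < b := lt_trans (by positivity) hb
  have hb0' : 0 < b := by exact_mod_cast hb0
  -- Chosen so that k times the truncated mean, at most 2 C b k², is at most A k² q/4, and q/2 ≤ Q.
  obtain ⟨A, hA⟩ := exists_nat_gt (8 * C * b / q)
  have hA0 : (0 : ℝ) < A := lt_trans (by positivity) hA
  refine ⟨A, by exact_mod_cast hA0, fun k hk => ?_⟩
  have hk' : (1 : ℝ) ≤ k := by exact_mod_cast hk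
  set m := (b * k) ^ 2 with hm
  have hm0 : 0 < m := by positivity
  have hsm : √(m : ℝ) = b * k := by
    rw [hm]
    push_cast
    exact Real.sqrt_sq (by positivity)
  set Q := ∑ j ∈ Finset.range m, f j with hQ
  set a := ∑ j ∈ Finset.range m, ((j : ℝ) + 1) * f j with ha
  have h1 : a ≤ 2 * C * (b * k) := hsm ▸ sum_range_succ_mul_le hC.le hfC m
  have h2 : q - Q ≤ 2 * C / (b * k) := hsm ▸ sub_sum_range_le hC.le hfC hsum hm0
  have h3 : 2 * C / (b * k) ≤ q * (1 / (2 * k)) := by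
    rw [div_lt_iff₀ hq] at hb
    rw [mul_one_div, div_le_div_iff₀ (by positivity) (by positivity)]
    nlinarith
  have h4 : q * (1 + -(1 / (2 * k))) ≤ Q := by linarith
  have h5 : 1 / (2 * (k : ℝ)) ≤ 1 / 2 := by
    refine one_div_le_one_div_of_le (by norm_num) (by linarith)
  have hQ2 : q / 2 ≤ Q := by nlinarith
  have hQ0 : 0 < Q := by linarith
  have h6 : q ^ k / 2 ≤ Q ^ k := by
    have hB := one_add_mul_le_pow (a := -(1 / (2 * (k : ℝ)))) (by linarith) k
    have e : 1 + (k : ℝ) * -(1 / (2 * k)) = 1 / 2 := by field_simp; norm_num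
    rw [e] at hB
    have h7 := pow_le_pow_left₀ (mul_nonneg hq.le (by linarith)) h4 k
    rw [mul_pow] at h7
    nlinarith [pow_pos hq k]
  have h8 := renewal_lower_bound hf hp hp0 hrec m (A * k ^ 2) k (A * k ^ 2) le_rfl
  rw [← hQ, ← ha] at h8
  have h9 : k * a * Q ^ (k - 1) ≤ ((A * k ^ 2 : ℕ) : ℝ) * (Q ^ k / 2) := by
    have hQk : Q ^ k = Q ^ (k - 1) * Q := by rw [← pow_succ, Nat.sub_add_cancel hk]
    have h10 : k * a ≤ ((A * k ^ 2 : ℕ) : ℝ) * (Q / 2) := by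
      rw [div_lt_iff₀ hq] at hA
      push_cast
      calc k * a ≤ k * (2 * C * (b * k)) := by gcongr
        _ = 8 * C * b * (k ^ 2 / 4) := by ring
        _ ≤ A * q * (k ^ 2 / 4) := by gcongr
        _ = A * k ^ 2 * ((q / 2) / 2) := by ring
        _ ≤ _ := by gcongr
    calc k * a * Q ^ (k - 1) ≤ ((A * k ^ 2 : ℕ) : ℝ) * (Q / 2) * Q ^ (k - 1) := by gcongr
      _ = _ := by rw [hQk]; ring
  have hD : (0 : ℝ) < ((A * k ^ 2 : ℕ) : ℝ) := by
    push_cast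
    positivity
  have h11 : ((A * k ^ 2 : ℕ) : ℝ) * (Q ^ k / 2) ≤ ((A * k ^ 2 : ℕ) : ℝ) * p k (A * k ^ 2) := by
    linarith
  have h12 := le_of_mul_le_mul_left h11 hD
  linarith

namespace IsSimpleRandomWalkSteps

variable {Ω : Type*} [MeasurableSpace Ω] {d : ℕ} {μ : Measure Ω} {X : ℕ → Ω → (Fin d → ℤ)}
variable [IsProbabilityMeasure μ]

/-- Returning `k` times within a time of order `k²` has a probability comparable with that of
returning `k` times at all. -/
theorem exists_le_measureReal_le_localTime (hX : IsSimpleRandomWalkSteps d μ X) (hd : 3 ≤ d)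
    (hq : escapeProb μ X < 1) :
    ∃ A : ℕ, 0 < A ∧ ∀ k, 0 < k → (1 - escapeProb μ X) ^ k / 4 ≤
      μ.real {ω | k ≤ localTime X 0 (A * k ^ 2) ω} := by
  obtain ⟨C, hC, hfC⟩ := hX.exists_measureReal_walk_eq_zero_le hd
  refine exists_renewal_lower_bound (f := fun j => μ.real (firstReturn X (j + 1)))
    (p := fun k l => μ.real {ω | k ≤ localTime X 0 l ω}) hC (fun j => measureReal_nonneg)
    (fun j => ?_) hX.hasSum_firstReturn (by linarith) (fun k l => measureReal_nonneg)
    (fun l => ?_) fun k l => hX.sum_firstReturn_mul_le (by omega) k l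
  · have h := hfC (j + 1) (Nat.succ_pos j)
    push_cast at h
    exact (measureReal_firstReturn_le (j + 1)).trans h
  · simp

end IsSimpleRandomWalkSteps

/-! ### Elementary asymptotics. -/

theorem eventually_exp_neg_mul_rpow_le {c ε : ℝ} (hc : 0 < c) (hε : 0 < ε) :
    ∀ᶠ j : ℕ in atTop, Real.exp (-(c * (j : ℝ) ^ ε)) ≤ 1 / (j : ℝ) ^ 2 := by
  have h := ((isLittleO_log_rpow_atTop hε).bound (half_pos hc)).natCast_atTop
  filter_upwards [h, eventually_gt_atTop 0] with j hj hj0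
  have hj' : (0 : ℝ) < j := by exact_mod_cast hj0
  rw [Real.norm_of_nonneg (Real.rpow_nonneg hj'.le _)] at hj
  have h1 := (le_abs_self _).trans hj
  calc Real.exp (-(c * (j : ℝ) ^ ε)) ≤ Real.exp (-(2 * Real.log j)) :=
        Real.exp_le_exp.2 (by linarith)
    _ = 1 / (j : ℝ) ^ 2 := by
        rw [Real.exp_neg, mul_comm, Real.exp_mul, Real.exp_log hj', Real.rpow_ofNat, one_div]

theorem eventually_log_mul_log_two_le {b : ℝ} (hb : 0 < b) :
    ∀ᶠ j : ℕ in atTop, b * Real.log (j * Real.log 2) ≤ (j + 1) * Real.log 2 := by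
  have hl := Real.log_pos one_lt_two
  have h := (Real.isLittleO_log_id_atTop.bound (inv_pos.2 hb))
  have ht : Tendsto (fun j : ℕ => (j : ℝ) * Real.log 2) atTop atTop :=
    tendsto_natCast_atTop_atTop.atTop_mul_const hl
  filter_upwards [ht.eventually h] with j hj
  have h0 : 0 ≤ (j : ℝ) * Real.log 2 := by positivity
  rw [id, Real.norm_of_nonneg h0] at hj
  have h1 := mul_le_mul_of_nonneg_left ((le_abs_self _).trans hj) hb.le
  rw [mul_inv_cancel_left₀ hb.ne'] at h1
  linarith

theorem eventually_mul_sq_le_two_pow (K : ℝ) :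
    ∀ᶠ j : ℕ in atTop, K * (j : ℝ) ^ 2 ≤ 2 ^ j := by
  have h := (isLittleO_pow_const_const_pow_of_one_lt (R := ℝ) 2 one_lt_two).bound
    (inv_pos.2 (by positivity : 0 < |K| + 1))
  filter_upwards [h] with j hj
  rw [Real.norm_of_nonneg (by positivity), Real.norm_of_nonneg (by positivity),
    inv_mul_eq_div, le_div_iff₀ (by positivity)] at hj
  nlinarith [le_abs_self K, sq_nonneg (j : ℝ)]

theorem sum_inv_mul_sqrt_succ_le (l : ℕ) :
    ∑ j ∈ Finset.range l, 1 / (((j : ℝ) + 1) * √((j : ℝ) + 1)) ≤ 3 := by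
  rcases l with _ | l
  · simp
  -- The subtracted tail makes the induction telescope.
  suffices h : ∑ j ∈ Finset.range (l + 1), 1 / (((j : ℝ) + 1) * √((j : ℝ) + 1)) ≤
      3 - 2 * (1 / √((l : ℝ) + 1)) by
    have : 0 ≤ 2 * (1 / √((l : ℝ) + 1)) := by positivity
    linarith
  induction l with
  | zero => norm_num
  | succ l ih =>
    rw [Finset.sum_range_succ]
    have h := inv_mul_sqrt_succ_le (Nat.succ_pos l)
    push_cast at h ⊢
    linarith

/-! ### Nontriviality of the escape probability. -/

namespace IsSimpleRandomWalkSteps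

variable {Ω : Type*} [MeasurableSpace Ω] {d : ℕ} {μ : Measure Ω} {X : ℕ → Ω → (Fin d → ℤ)}
variable [IsProbabilityMeasure μ]

/-- A step followed by its reverse returns to the origin at time 2 with positive probability. -/
theorem escapeProb_lt_one (hX : IsSimpleRandomWalkSteps d μ X) (hd : d ≠ 0) :
    escapeProb μ X < 1 := by
  let i : Fin d := ⟨0, Nat.pos_of_ne_zero hd⟩
  have hd' : (0 : ℝ) < d := by exact_mod_cast Nat.pos_of_ne_zero hd
  have hind : IndepFun (X 0) (X 1) μ := hX.indep.indepFun zero_ne_one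
  have h := hind.measure_inter_preimage_eq_mul {Pi.single i 1} {-Pi.single i 1}
    (measurableSet_singleton _) (measurableSet_singleton _)
  have hreal : μ.real (X 0 ⁻¹' {Pi.single i 1} ∩ X 1 ⁻¹' {-Pi.single i 1}) =
      1 / (2 * (d : ℝ)) * (1 / (2 * (d : ℝ))) := by
    rw [measureReal_def, h, ENNReal.toReal_mul]
    exact congrArg₂ (· * ·) (hX.prob_pos 0 i) (hX.prob_neg 1 i)
  have hm : MeasurableSet (X 0 ⁻¹' {Pi.single i 1} ∩ X 1 ⁻¹' {-Pi.single i 1}) :=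
    (hX.measurable 0 (measurableSet_singleton _)).inter
      (hX.measurable 1 (measurableSet_singleton _))
  have hle : escapeProb μ X ≤
      μ.real (X 0 ⁻¹' {Pi.single i 1} ∩ X 1 ⁻¹' {-Pi.single i 1})ᶜ := by
    refine measureReal_mono fun ω hω h' => hω 2 one_le_two ?_
    have e0 : X 0 ω = Pi.single i 1 := h'.1
    have e1 : X 1 ω = -Pi.single i 1 := h'.2
    simp [walk, Finset.sum_range_succ, e0, e1]
  rw [probReal_compl_eq_one_sub hm, hreal] at hle
  have : 0 < 1 / (2 * (d : ℝ)) * (1 / (2 * (d : ℝ))) := by positivity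
  linarith

/-- Markov's inequality for the local time at the origin. -/
theorem mul_measureReal_le_localTime_le (hX : IsSimpleRandomWalkSteps d μ X) (k l : ℕ) :
    k * μ.real {ω | k ≤ localTime X 0 l ω} ≤
      ∑ n ∈ Finset.Icc 1 l, μ.real {ω | walk X n ω = 0} := by
  have hm : ∀ n, MeasurableSet {ω | walk X n ω = 0} := fun n =>
    hX.measurable_walk n (measurableSet_singleton _)
  have hi : ∀ n, Integrable ({ω | walk X n ω = 0}.indicator fun _ => (1 : ℝ)) μ := fun n =>
    (integrable_const _).indicator (hm n)
  have heq : ∀ ω, (localTime X 0 l ω : ℝ) =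
      ∑ n ∈ Finset.Icc 1 l, {ω | walk X n ω = 0}.indicator (fun _ => (1 : ℝ)) ω := fun ω => by
    rw [localTime_eq_sum, Nat.cast_sum]
    refine Finset.sum_congr rfl fun n _ => ?_
    simp [Set.indicator_apply]
  have hint : Integrable (fun ω => (localTime X 0 l ω : ℝ)) μ := by
    simp_rw [heq]
    exact integrable_finsetSum _ fun n _ => hi n
  have h := mul_meas_ge_le_integral_of_nonneg
    (Eventually.of_forall fun ω => Nat.cast_nonneg (localTime X 0 l ω)) hint k
  simp only [Nat.cast_le] at h
  refine h.trans_eq ?_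
  simp_rw [heq]
  rw [integral_finsetSum _ fun n _ => hi n]
  refine Finset.sum_congr rfl fun n _ => ?_
  rw [integral_indicator (hm n), setIntegral_const, smul_eq_mul, mul_one]

/-- The simple random walk is transient in dimension at least three. -/
theorem escapeProb_pos (hX : IsSimpleRandomWalkSteps d μ X) (hd : 3 ≤ d) :
    0 < escapeProb μ X := by
  by_contra hneg
  have h0 : escapeProb μ X = 0 := le_antisymm (not_lt.1 hneg) measureReal_nonneg
  -- If γ = 0, at least k returns by time A k² have probability at least 1/4 for every k, so the
  -- expected number of returns is at least k/4; but it never exceeds 3C. Hence k > 12C is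
  -- contradictory.
  obtain ⟨A, -, hA⟩ := hX.exists_le_measureReal_le_localTime hd (by rw [h0]; exact one_pos)
  obtain ⟨C, hC, hfC⟩ := hX.exists_measureReal_walk_eq_zero_le hd
  obtain ⟨k, hk⟩ := exists_nat_gt (12 * C)
  have hk0 : 0 < k := by
    have : (0 : ℝ) < k := lt_trans (by positivity) hk
    exact_mod_cast this
  have h1 := hA k hk0
  rw [h0, sub_zero, one_pow] at h1
  have h2 := hX.mul_measureReal_le_localTime_le k (A * k ^ 2)
  have h3 : ∑ n ∈ Finset.Icc 1 (A * k ^ 2), μ.real {ω | walk X n ω = 0} ≤ C * 3 := by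
    calc _ = ∑ j ∈ Finset.range (A * k ^ 2), μ.real {ω | walk X (j + 1) ω = 0} := by
          rw [Finset.range_eq_Ico,
            Finset.sum_Ico_add' (fun n => μ.real {ω | walk X n ω = 0}) 0 _ 1]
          rfl
      _ ≤ ∑ j ∈ Finset.range (A * k ^ 2), C * (1 / (((j : ℝ) + 1) * √((j : ℝ) + 1))) := by
          refine Finset.sum_le_sum fun j _ => (hfC (j + 1) (Nat.succ_pos j)).trans_eq ?_
          rw [mul_one_div]
          push_cast
          rfl
      _ ≤ C * 3 := by
          rw [← Finset.mul_sum]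
          exact mul_le_mul_of_nonneg_left (sum_inv_mul_sqrt_succ_le _) hC.le
  have h4 := mul_le_mul_of_nonneg_left h1 (Nat.cast_nonneg (α := ℝ) k)
  linarith

end IsSimpleRandomWalkSteps

/-! ### Borel–Cantelli along powers of two. -/

namespace IsSimpleRandomWalkSteps

variable {Ω : Type*} [MeasurableSpace Ω] {d : ℕ} {μ : Measure Ω} {X : ℕ → Ω → (Fin d → ℤ)}
variable [IsProbabilityMeasure μ]

theorem eventually_measureReal_maxLocalTime_lt_le (hX : IsSimpleRandomWalkSteps d μ X)
    (hd : 3 ≤ d) (h0 : 0 < escapeProb μ X) (h1 : escapeProb μ X < 1) {ε : ℝ} (hε : 0 < ε) :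
    ∀ᶠ j : ℕ in atTop, μ.real {ω | maxLocalTime X (2 ^ j) ω <
      ⌊lambdaConst μ X * ((j + 1) * Real.log 2 - (2 + ε) * Real.log (j * Real.log 2))⌋₊ + 1} ≤
        1 / (j : ℝ) ^ 2 := by
  obtain ⟨A, hA, hp⟩ := hX.exists_le_measureReal_le_localTime hd h1
  set q := 1 - escapeProb μ X with hq
  have hq0 : 0 < q := by linarith
  have hlogq : Real.log q < 0 := Real.log_neg hq0 (by linarith)
  set lam := lambdaConst μ X with hlam
  have hlam' : lam = -1 / Real.log q := rfl
  have hlam0 : 0 < lam := by rw [hlam']; exact div_pos_of_neg_of_neg (by norm_num) hlogq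
  have hll : lam * Real.log q = -1 := by rw [hlam', div_mul_cancel₀ _ hlogq.ne]
  have hl2 := Real.log_pos one_lt_two
  have hA' : (0 : ℝ) < A := by exact_mod_cast hA
  -- A slope with k ≤ K j, used to bound the block length A k².
  set K := 2 * lam * Real.log 2 + 1 with hK
  have hK0 : 0 < K := by positivity
  -- The 16 collects q/2 from rounding k up and from using j + 1, the 1/4 of the renewal bound, and
  -- a 1/2 from rounding the number of blocks down.
  set c := q * Real.log 2 ^ (2 + ε) / (16 * A * K ^ 2) with hc
  have hc0 : 0 < c := by positivity
  filter_upwards [eventually_exp_neg_mul_rpow_le hc0 hε,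
    eventually_log_mul_log_two_le (by linarith : 0 < 2 + ε),
    eventually_mul_sq_le_two_pow (2 * A * K ^ 2), eventually_ge_atTop 2] with j e1 e2 e3 e4
  refine le_trans ?_ e1
  have hj : (2 : ℝ) ≤ j := by exact_mod_cast e4
  have hj0 : (0 : ℝ) < j := by linarith
  have hlogj : 0 ≤ Real.log (j * Real.log 2) := by
    refine Real.log_nonneg ?_
    have := Real.log_two_gt_d9
    nlinarith
  set t := (j + 1) * Real.log 2 - (2 + ε) * Real.log (j * Real.log 2) with ht
  have ht0 : 0 ≤ t := by linarith
  set k := ⌊lam * t⌋₊ + 1 with hk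
  have hk0 : 0 < k := Nat.succ_pos _
  have hk0' : (0 : ℝ) < k := by exact_mod_cast hk0
  have hkt : (k : ℝ) ≤ lam * t + 1 := by
    rw [hk]
    push_cast
    linarith [Nat.floor_le (mul_nonneg hlam0.le ht0)]
  have hkK : (k : ℝ) ≤ K * j := by
    have h2 : t ≤ 2 * j * Real.log 2 := by nlinarith
    have h3 := mul_le_mul_of_nonneg_left h2 hlam0.le
    calc (k : ℝ) ≤ lam * t + 1 := hkt
      _ ≤ lam * (2 * j * Real.log 2) + j := by linarith
      _ = K * j := by rw [hK]; ring
  have hqk : q / 2 * ((j * Real.log 2) ^ (2 + ε) / 2 ^ j) ≤ q ^ k := by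
    have h2 : q ^ k = Real.exp (k * Real.log q) := by rw [Real.exp_nat_mul, Real.exp_log hq0]
    have h3 : (lam * t + 1) * Real.log q ≤ k * Real.log q :=
      mul_le_mul_of_nonpos_right hkt hlogq.le
    have h4 : (lam * t + 1) * Real.log q =
        Real.log q - Real.log 2 - j * Real.log 2 + Real.log (j * Real.log 2) * (2 + ε) := by
      calc (lam * t + 1) * Real.log q = lam * Real.log q * t + Real.log q := by ring
        _ = _ := by rw [hll, ht]; ring
    rw [h2]
    refine le_trans (le_of_eq ?_) (Real.exp_le_exp.2 h3)
    rw [h4, Real.exp_add, Real.exp_sub, Real.exp_sub, Real.exp_log hq0, Real.exp_log two_pos,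
      Real.exp_nat_mul, Real.exp_log two_pos, Real.rpow_def_of_pos (by positivity)]
    ring
  set N := 2 ^ j / (A * k ^ 2) with hN
  have hAk : 2 * (A * (k : ℝ) ^ 2) ≤ 2 ^ j := by
    refine le_trans ?_ e3
    have : (k : ℝ) ^ 2 ≤ (K * j) ^ 2 := by gcongr
    nlinarith
  have hAk0 : 0 < A * (k : ℝ) ^ 2 := by positivity
  have hN1 : (2 : ℝ) ^ j / (2 * (A * K ^ 2 * j ^ 2)) ≤ N := by
    have h2 : (2 : ℝ) ^ j < (N + 1) * (A * k ^ 2) := by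
      have := Nat.lt_mul_of_div_lt (Nat.lt_succ_self N) (by positivity : 0 < A * k ^ 2)
      have h3 : ((2 ^ j : ℕ) : ℝ) < (((N + 1) * (A * k ^ 2) : ℕ) : ℝ) := by exact_mod_cast this
      push_cast at h3
      exact h3
    -- The quotient is at least 2, so rounding it down costs at most a factor 2.
    have h3 : (2 : ℝ) ^ j / (2 * (A * k ^ 2)) ≤ N := by
      rw [div_le_iff₀ (by positivity)]
      nlinarith
    refine le_trans ?_ h3
    have h4 : (k : ℝ) ^ 2 ≤ K ^ 2 * j ^ 2 := by rw [← mul_pow]; gcongr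
    have h5 : A * (k : ℝ) ^ 2 ≤ A * K ^ 2 * j ^ 2 := by
      rw [mul_assoc]; gcongr
    gcongr
  have hNn : N * (A * k ^ 2) ≤ 2 ^ j := Nat.div_mul_le_self _ _
  refine (hX.measureReal_maxLocalTime_lt_le (by omega) hNn).trans ?_
  have hp1 := hp k hk0
  set P := μ.real {ω | k ≤ localTime X 0 (A * k ^ 2) ω} with hP
  have hP1 : P ≤ 1 := measureReal_le_one
  calc (1 - P) ^ N ≤ Real.exp (-P) ^ N :=
        pow_le_pow_left₀ (by linarith) (Real.one_sub_le_exp_neg P) N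
    _ = Real.exp (-(P * N)) := by
        rw [← Real.exp_nat_mul]
        congr 1
        ring
    _ ≤ Real.exp (-(c * (j : ℝ) ^ ε)) := by
        refine Real.exp_le_exp.2 (neg_le_neg ?_)
        calc c * (j : ℝ) ^ ε = q / 2 * ((j * Real.log 2) ^ (2 + ε) / 2 ^ j) / 4 *
              ((2 : ℝ) ^ j / (2 * (A * K ^ 2 * j ^ 2))) := by
              rw [Real.mul_rpow hj0.le hl2.le, Real.rpow_add hj0, Real.rpow_two, hc]
              field_simp
              norm_num
          _ ≤ P * N := by
              refine mul_le_mul (by linarith) hN1 (by positivity) measureReal_nonneg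

theorem ae_eventually_le_maxLocalTime (hX : IsSimpleRandomWalkSteps d μ X)
    (hd : 3 ≤ d) (h0 : 0 < escapeProb μ X) (h1 : escapeProb μ X < 1) {ε : ℝ} (hε : 0 < ε) :
    ∀ᵐ ω ∂μ, ∀ᶠ n : ℕ in atTop,
      lambdaConst μ X * Real.log n - lambdaConst μ X * (2 + ε) * Real.log (Real.log n) ≤
        maxLocalTime X n ω := by
  have hlam0 : 0 < lambdaConst μ X :=
    div_pos_of_neg_of_neg (by norm_num) (Real.log_neg (by linarith) (by linarith))
  set lam := lambdaConst μ X
  -- Mixing j + 1 in the main term with j in the correction makes this threshold dominate the target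
  -- for every n in [2^j, 2^(j+1)).
  set B : ℕ → Set Ω := fun j => {ω | maxLocalTime X (2 ^ j) ω <
    ⌊lam * ((j + 1) * Real.log 2 - (2 + ε) * Real.log (j * Real.log 2))⌋₊ + 1} with hB
  have hsum : Summable fun j => μ.real (B j) := by
    refine Summable.of_norm_bounded_eventually_nat
      (Real.summable_one_div_nat_pow.2 one_lt_two) ?_
    filter_upwards [hX.eventually_measureReal_maxLocalTime_lt_le hd h0 h1 hε] with j hj
    rwa [Real.norm_of_nonneg measureReal_nonneg]
  have hfin : ∑' j, μ (B j) ≠ ⊤ := by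
    have := hsum.tsum_ofReal_ne_top
    simpa only [measureReal_def, ENNReal.ofReal_toReal (measure_ne_top μ _)] using this
  filter_upwards [ae_eventually_notMem hfin] with ω hω
  have hlog : Tendsto (fun n => Nat.log 2 n) atTop atTop :=
    tendsto_atTop.2 fun b => by
      filter_upwards [eventually_ge_atTop (2 ^ b)] with n hn
      exact Nat.le_log_of_pow_le one_lt_two hn
  filter_upwards [hlog.eventually hω, hlog.eventually_gt_atTop 0, eventually_gt_atTop 0]
    with n hn hj hn0
  set j := Nat.log 2 n with hjdef
  have hn0' : (0 : ℝ) < n := by exact_mod_cast hn0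
  have hj' : (0 : ℝ) < j := by exact_mod_cast hj
  have hl2 := Real.log_pos one_lt_two
  have hlow : 2 ^ j ≤ n := Nat.pow_log_le_self 2 hn0.ne'
  have hup : n < 2 ^ (j + 1) := Nat.lt_pow_succ_log_self one_lt_two n
  have hlow' : j * Real.log 2 ≤ Real.log n := by
    rw [← Real.log_pow]
    exact Real.log_le_log (by positivity) (by exact_mod_cast hlow)
  have hup' : Real.log n ≤ (j + 1) * Real.log 2 := by
    have : Real.log n ≤ Real.log (2 ^ (j + 1)) :=
      Real.log_le_log hn0' (by exact_mod_cast hup.le)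
    rw [Real.log_pow] at this
    exact_mod_cast this
  have hloglog : Real.log (j * Real.log 2) ≤ Real.log (Real.log n) :=
    Real.log_le_log (by positivity) hlow'
  have hξ : ⌊lam * ((j + 1) * Real.log 2 - (2 + ε) * Real.log (j * Real.log 2))⌋₊ + 1 ≤
      maxLocalTime X n ω := (not_lt.1 hn).trans (maxLocalTime_mono hlow ω)
  calc lam * Real.log n - lam * (2 + ε) * Real.log (Real.log n)
      = lam * (Real.log n - (2 + ε) * Real.log (Real.log n)) := by ring
    _ ≤ lam * ((j + 1) * Real.log 2 - (2 + ε) * Real.log (j * Real.log 2)) := by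
        gcongr
    _ ≤ ⌊lam * ((j + 1) * Real.log 2 - (2 + ε) * Real.log (j * Real.log 2))⌋₊ + 1 :=
        (Nat.lt_floor_add_one _).le
    _ ≤ maxLocalTime X n ω := by exact_mod_cast hξ

end IsSimpleRandomWalkSteps

theorem mainTheorem2 {Ω : Type*} [MeasurableSpace Ω] (μ : Measure Ω) [IsProbabilityMeasure μ]
    (d : ℕ) (hd : 3 ≤ d) (X : ℕ → Ω → (Fin d → ℤ)) (hX : IsSimpleRandomWalkSteps d μ X) :
    ∀ᵐ ω ∂μ, ∀ ε : ℝ, 0 < ε → ∃ n₀ : ℕ, ∀ n : ℕ, n₀ ≤ n →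
      lambdaConst μ X * Real.log n - lambdaConst μ X * (2 + ε) * Real.log (Real.log n)
        ≤ (maxLocalTime X n ω : ℝ) := by
  have hγ0 := hX.escapeProb_pos hd
  have hγ1 := hX.escapeProb_lt_one (by omega)
  have hlam0 : 0 < lambdaConst μ X :=
    div_pos_of_neg_of_neg (by norm_num) (Real.log_neg (by linarith) (by linarith))
  -- Countably many values ε = 1/(r + 1) suffice: once log n ≥ 1, the bound only weakens as ε grows.
  have h := ae_all_iff.2 fun r : ℕ =>
    hX.ae_eventually_le_maxLocalTime hd hγ0 hγ1 (Nat.one_div_pos_of_nat (α := ℝ) (n := r))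
  filter_upwards [h] with ω hω ε hε
  obtain ⟨r, hr⟩ := exists_nat_one_div_lt hε
  have hlog : Tendsto (fun n : ℕ => Real.log n) atTop atTop :=
    Real.tendsto_log_atTop.comp tendsto_natCast_atTop_atTop
  rw [← eventually_atTop]
  filter_upwards [hω r, hlog.eventually_ge_atTop 1] with n hn hn1
  refine le_trans ?_ hn
  have : 0 ≤ Real.log (Real.log n) := Real.log_nonneg hn1
  gcongr
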